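/- Let $\&$ be a continuous t-norm on $[0,1]$: a continuous operation $\&:[0,1]^2\to[0,1]$ such that $([0,1],\&,1)$ is a commutative quantale, i.e. a commutative monoid whose operation distributes over arbitrary joins. For any commutative quantale $\mathcal Q=(Q,\&,1_{\mathcal Q})$ let $\to$ be its implication, $p\& q\le r\iff q\le p\to r$. A $\mathcal Q$-order on a set $X$ is a map $P:X\times X\to Q$ with $P(x,x)\ge 1_{\mathcal Q}$ and $P(y,z)\& P(x,y)\le P(x,z)$; the canonical $\mathcal Q$-order on $Q$ is $d_L(p,q)=p\to q$. A fuzzy lower set of $(X,P)$ is a map $\phi:X\to Q$ with $\phi(x)\& P(y,x)\le\phi(y)$ for all $x,y$; a fuzzy upper set is a map $\psi:X\to Q$ with $P(x,y)\&\psi(x)\le\psi(y)$ for all $x,y$; and $\phi\otimes\psi=\bigvee_{x\in X}\phi(x)\&\psi(x)$. A flat ideal of $(X,P)$ is a fuzzy lower set $\phi$ with $\bigvee_{x\in X}\phi(x)\ge 1_{\mathcal Q}$ and $\phi\otimes(\psi_1\wedge\psi_2)=(\phi\otimes\psi_1)\wedge(\phi\otimes\psi_2)$ for all fuzzy upper sets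 $\psi_1,\psi_2$ of $(X,P)$. Call $x\in[0,1]$ idempotent if $x\& x=x$, and for $c\in[0,1]$ put $$c^+=\inf\{x\in[0,1]\mid x\ge c,\ x\& x=x\},\qquad c^-=\sup\{x\in[0,1]\mid x\le c,\ x\& x=x\}.$$ Then $([c^-,c^+],\&,c^+)$ is a commutative quantale, with canonical order $d_L^c(x,y)=\min\{c^+,x\to y\}$, where $\to$ is the implication of $([0,1],\&,1)$. **Theorem.** A fuzzy lower set $\phi$ of $([0,1],d_L)$ is a flat ideal of $([0,1],d_L)$ if and only if the following three conditions hold. - (F1) $\phi(0)=1$. - (F2) For each $c\in[0,1]$, if $\phi(c)\ge c^+$ then $\phi(c)$ is idempotent. - (F3) For each $c\in[0,1]$, if $c$ is not idempotent and $\phi(c^-)>c^-$, then the assignment $x\mapsto c^+\wedge\phi(x)$ defines a map $[c^-,c^+]\to[c^-,c^+]$ which is a flat ideal of $([c^-,c^+],d_L^c)$ valued in the quantale $([c^-,c^+],\&,c^+)$. -/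

import Mathlib

noncomputable section

namespace FuzzyOrder

open Set

/-- A commutative quantale structure on the complete lattice `Q`: a commutative monoid `(Q, &, 1)`
whose operation distributes over arbitrary joins. The structure is bundled (instead of using the
class `IsQuantale`) because one lattice carries many of them: the unit interval has one for each
left continuous t-norm. Distributivity in the other variable follows from commutativity. -/
structure CommQuantale (Q : Type*) [CompleteLattice Q] where
  mul : Q → Q → Q
  unit : Q
  mul_comm : ∀ p q, mul p q = mul q p
  mul_assoc : ∀ p q r, mul (mul p q) r = mul p (mul q r)
  mul_unit : ∀ p, mul p unit = p
  mul_sSup : ∀ (p : Q) (s : Set Q), mul p (sSup s) = ⨆ q ∈ s, mul p q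

namespace CommQuantale

variable {Q : Type*} [CompleteLattice Q] (𝒬 : CommQuantale Q)

/-- The implication `p → r` of a commutative quantale; see `mul_le_iff` for its adjoint
property. -/
def imp (p r : Q) : Q := sSup {q | 𝒬.mul p q ≤ r}

/-- `x & x = x`. -/
def IsIdem (x : Q) : Prop := 𝒬.mul x x = x

theorem mul_le_mul_left (p : Q) {q r : Q} (h : q ≤ r) : 𝒬.mul p q ≤ 𝒬.mul p r := by
  have h1 : sSup ({q, r} : Set Q) = r := by rw [sSup_pair]; exact sup_eq_right.mpr h
  rw [← h1, 𝒬.mul_sSup]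
  exact le_iSup₂_of_le q (by simp) le_rfl

theorem mul_le_mul {p p' q q' : Q} (h : p ≤ p') (h' : q ≤ q') : 𝒬.mul p q ≤ 𝒬.mul p' q' := by
  refine (𝒬.mul_le_mul_left p h').trans ?_
  rw [𝒬.mul_comm p, 𝒬.mul_comm p']
  exact 𝒬.mul_le_mul_left q' h

/-- The adjoint property `p & q ≤ r ↔ q ≤ p → r`. -/
theorem mul_le_iff (p q r : Q) : 𝒬.mul p q ≤ r ↔ q ≤ 𝒬.imp p r := by
  refine ⟨fun h => le_sSup h, fun h => (𝒬.mul_le_mul_left p h).trans ?_⟩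
  rw [imp, 𝒬.mul_sSup]
  exact iSup₂_le fun _ h => h

end CommQuantale

/-- An order on `X` valued in the commutative quantale `𝒬`. -/
structure QOrder {Q : Type*} [CompleteLattice Q] (𝒬 : CommQuantale Q) (X : Type*) where
  rel : X → X → Q
  unit_le_rel : ∀ x, 𝒬.unit ≤ rel x x
  rel_trans : ∀ x y z, 𝒬.mul (rel y z) (rel x y) ≤ rel x z

/-- The canonical order `d_L(p, q) = p → q` of a commutative quantale on itself. -/
def CommQuantale.dL {Q : Type*} [CompleteLattice Q] (𝒬 : CommQuantale Q) : QOrder 𝒬 Q where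
  rel p q := 𝒬.imp p q
  unit_le_rel x := by rw [← 𝒬.mul_le_iff, 𝒬.mul_unit]
  rel_trans x y z := by
    rw [← 𝒬.mul_le_iff, 𝒬.mul_comm (𝒬.imp y z), ← 𝒬.mul_assoc]
    refine (𝒬.mul_le_mul ((𝒬.mul_le_iff _ _ y).mpr le_rfl) le_rfl).trans ?_
    exact (𝒬.mul_le_iff _ _ _).mpr le_rfl

section FlatIdeal

variable {Q : Type*} [CompleteLattice Q] {𝒬 : CommQuantale Q} {X : Type*}

def IsFuzzyLowerSet (P : QOrder 𝒬 X) (φ : X → Q) : Prop :=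
  ∀ x y, 𝒬.mul (φ x) (P.rel y x) ≤ φ y

def IsFuzzyUpperSet (P : QOrder 𝒬 X) (ψ : X → Q) : Prop :=
  ∀ x y, 𝒬.mul (P.rel x y) (ψ x) ≤ ψ y

/-- The tensor product `φ ⊗ ψ`, the degree to which `φ` meets `ψ`. -/
def tensor (𝒬 : CommQuantale Q) (φ ψ : X → Q) : Q := ⨆ x, 𝒬.mul (φ x) (ψ x)

/-- A flat ideal: an inhabited, flat fuzzy lower set. -/
structure IsFlatIdeal (P : QOrder 𝒬 X) (φ : X → Q) : Prop where
  isFuzzyLowerSet : IsFuzzyLowerSet P φ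
  inhabited : 𝒬.unit ≤ ⨆ x, φ x
  flat : ∀ ψ₁ ψ₂ : X → Q, IsFuzzyUpperSet P ψ₁ → IsFuzzyUpperSet P ψ₂ →
    tensor 𝒬 φ (fun x => ψ₁ x ⊓ ψ₂ x) = tensor 𝒬 φ ψ₁ ⊓ tensor 𝒬 φ ψ₂

end FlatIdeal

/-- A continuous t-norm: a continuous operation `&` on `[0,1]` such that `([0,1], &, 1)` is a
commutative quantale. -/
structure ContinuousTNorm extends CommQuantale unitInterval where
  unit_eq_one : unit = 1
  continuous_mul : Continuous fun p : unitInterval × unitInterval => mul p.1 p.2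

namespace ContinuousTNorm

variable (T : ContinuousTNorm)

/-- `c⁺`, the least idempotent above `c`. -/
def up (c : unitInterval) : unitInterval := sInf {x | c ≤ x ∧ T.IsIdem x}

/-- `c⁻`, the greatest idempotent below `c`. -/
def down (c : unitInterval) : unitInterval := sSup {x | x ≤ c ∧ T.IsIdem x}

theorem mul_one' (x : unitInterval) : T.mul x 1 = x := by
  rw [← T.unit_eq_one, T.mul_unit]

theorem mul_le_left (x y : unitInterval) : T.mul x y ≤ x :=
  (T.mul_le_mul_left x (unitInterval.le_one y)).trans (T.mul_one' x).le

theorem mul_le_right (x y : unitInterval) : T.mul x y ≤ y := by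
  rw [T.mul_comm]; exact T.mul_le_left y x

theorem mul_zero' (x : unitInterval) : T.mul x 0 = 0 :=
  le_antisymm (T.mul_le_right x 0) (unitInterval.nonneg _)

theorem isClosed_idem : IsClosed {x | T.IsIdem x} :=
  isClosed_eq (T.continuous_mul.comp (continuous_id.prodMk continuous_id)) continuous_id

theorem up_isIdem (c : unitInterval) : T.IsIdem (T.up c) := by
  have hc : IsClosed {x | c ≤ x ∧ T.IsIdem x} := isClosed_Ici.inter T.isClosed_idem
  have hne : {x | c ≤ x ∧ T.IsIdem x}.Nonempty := ⟨1, unitInterval.le_one c, T.mul_one' 1⟩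
  exact (hc.sInf_mem hne).2

theorem down_isIdem (c : unitInterval) : T.IsIdem (T.down c) := by
  have hc : IsClosed {x | x ≤ c ∧ T.IsIdem x} := isClosed_Iic.inter T.isClosed_idem
  have hne : {x | x ≤ c ∧ T.IsIdem x}.Nonempty := ⟨0, unitInterval.nonneg c, T.mul_zero' 0⟩
  exact (hc.sSup_mem hne).2

theorem le_up (c : unitInterval) : c ≤ T.up c := le_sInf fun _ h => h.1

theorem down_le (c : unitInterval) : T.down c ≤ c := sSup_le fun _ h => h.1

/-- An idempotent `b` acts as a unit below itself (this needs continuity of the t-norm). -/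
theorem mul_idem_of_le {b x : unitInterval} (hb : T.IsIdem b) (h : x ≤ b) : T.mul x b = x := by
  have hcont : Continuous fun y => T.mul b y :=
    T.continuous_mul.comp (continuous_const.prodMk continuous_id)
  have hx : x ∈ Icc (T.mul b 0) (T.mul b b) := by
    rw [T.mul_zero', hb]; exact ⟨unitInterval.nonneg x, h⟩
  obtain ⟨y, -, hy⟩ :=
    intermediate_value_Icc (f := fun y => T.mul b y) (a := 0) (b := b)
      (unitInterval.nonneg b) hcont.continuousOn hx
  have hy' : T.mul b y = x := hy
  rw [T.mul_comm, ← hy', ← T.mul_assoc, hb]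

/-- The quantale `([a,b], &, b)` cut out by two idempotents `a ≤ b`: the operation and the unit
are those of the t-norm restricted to `[a,b]`. -/
def restrict (a b : unitInterval) [hab : Fact (a ≤ b)] (ha : T.IsIdem a) (hb : T.IsIdem b) :
    CommQuantale (Icc a b) where
  mul x y := ⟨T.mul x y, ha.symm.le.trans (T.mul_le_mul x.2.1 y.2.1),
    (T.mul_le_left _ _).trans x.2.2⟩
  unit := ⟨b, hab.out, le_rfl⟩
  mul_comm x y := Subtype.ext (T.mul_comm _ _)
  mul_assoc x y z := Subtype.ext (T.mul_assoc _ _ _)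
  mul_unit x := Subtype.ext (T.mul_idem_of_le hb x.2.2)
  mul_sSup p s := by
    apply le_antisymm
    · rcases s.eq_empty_or_nonempty with rfl | hs
      · have h0 : ((sSup (∅ : Set (Icc a b)) : Icc a b) : unitInterval) = a := by
          rw [sSup_empty]; rfl
        refine Subtype.coe_le_coe.mp ?_
        show T.mul p _ ≤ _
        rw [h0]
        exact (T.mul_le_right _ _).trans (⨆ q ∈ (∅ : Set (Icc a b)), _ : Icc a b).2.1
      · refine Subtype.coe_le_coe.mp ?_
        show T.mul p _ ≤ _
        rw [Icc.coe_sSup hab.out hs, T.mul_sSup]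
        refine iSup₂_le ?_
        rintro _ ⟨q, hq, rfl⟩
        have := le_iSup₂ (f := fun (q : Icc a b) (_ : q ∈ s) =>
          (⟨T.mul p q, ha.symm.le.trans (T.mul_le_mul p.2.1 q.2.1),
            (T.mul_le_left _ _).trans p.2.2⟩ : Icc a b)) q hq
        exact Subtype.coe_le_coe.mpr this
    · refine iSup₂_le fun q hq => Subtype.coe_le_coe.mp ?_
      exact T.mul_le_mul_left p (Subtype.coe_le_coe.mpr (le_sSup hq))

/-- The implication of `([a,b], &, b)` is `min {b, x → y}`. -/
theorem coe_restrict_imp (a b : unitInterval) [hab : Fact (a ≤ b)] (ha : T.IsIdem a)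
    (hb : T.IsIdem b) (x y : Icc a b) :
    (((T.restrict a b ha hb).imp x y : Icc a b) : unitInterval) = b ⊓ T.imp x y := by
  apply le_antisymm
  · exact le_inf ((T.restrict a b ha hb).imp x y).2.2
      ((T.mul_le_iff _ _ _).mp (((T.restrict a b ha hb).mul_le_iff x _ y).mpr le_rfl))
  · have h1 : a ≤ T.imp x y := (T.mul_le_iff _ _ _).mp ((T.mul_le_right _ _).trans y.2.1)
    have h2 : (⟨b ⊓ T.imp x y, le_inf hab.out h1, inf_le_left⟩ : Icc a b) ≤
        (T.restrict a b ha hb).imp x y :=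
      ((T.restrict a b ha hb).mul_le_iff x _ y).mp
        ((T.mul_le_iff (x : unitInterval) _ (y : unitInterval)).mpr inf_le_right)
    exact h2

instance (c : unitInterval) : Fact (T.down c ≤ T.up c) := ⟨(T.down_le c).trans (T.le_up c)⟩

/-- The quantale `([c⁻,c⁺], &, c⁺)`. Its canonical order `(T.localQuantale c).dL` is
`d_L^c(x, y) = min {c⁺, x → y}`, see `coe_localQuantale_dL`. -/
def localQuantale (c : unitInterval) : CommQuantale (Icc (T.down c) (T.up c)) :=
  T.restrict (T.down c) (T.up c) (T.down_isIdem c) (T.up_isIdem c)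

theorem coe_localQuantale_dL (c : unitInterval) (x y : Icc (T.down c) (T.up c)) :
    ((T.localQuantale c).dL.rel x y : unitInterval) = T.up c ⊓ T.dL.rel x y :=
  T.coe_restrict_imp _ _ _ _ x y

end ContinuousTNorm

end FuzzyOrder

end

noncomputable section

namespace FuzzyOrder

open Set

/-! ### Flatness on generating upper sets. -/

section FlatIdeal

variable {Q : Type*} [CompleteLattice Q] {𝒬 : CommQuantale Q} {X : Type*}

/-! Since `[0,1]` is a chain, flatness reduces to the inequality p & φ(a) ∧ q & φ(b) ≤ ⋁ₓ φ(x) & (p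
& (a → x) ∧ q & (b → x)). An idempotent `e` acts by x & e = x ∧ e, so values separated by an
idempotent multiply to their minimum.

Necessity: (F2) comes from one instance of the inequality; (F3) is `IsFlatIdeal.restrict`, where
points outside [c⁻, c⁺] are discarded or truncated.

Sufficiency (`mul_inf_mul_le_of_le`): for a ≤ b the term x = b already suffices unless p < q and
φ(b) lies strictly between p⁻ and p⁺. In that case (F2) forces p⁻ ≤ b, and the inequality follows
from (F3) at c = p after clamping a, b, q to [p⁻, p⁺]. -/

/-- No distributivity is needed: once some `f i` is not below `r`, totality puts every `g j` below
`r`. -/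
theorem iSup_inf_iSup_le_of_total {ι κ : Type*} (hQ : ∀ a b : Q, a ≤ b ∨ b ≤ a) (f : ι → Q)
    (g : κ → Q) {r : Q} (h : ∀ i j, f i ⊓ g j ≤ r) : (⨆ i, f i) ⊓ (⨆ j, g j) ≤ r := by
  by_cases hf : ∀ i, f i ≤ r
  · exact inf_le_left.trans (iSup_le hf)
  · obtain ⟨i, hi⟩ := not_forall.mp hf
    refine inf_le_right.trans (iSup_le fun j => ?_)
    have hij := h i j
    rcases hQ (f i) (g j) with h' | h'
    · rw [inf_eq_left.mpr h'] at hij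
      exact absurd hij hi
    · rwa [inf_eq_right.mpr h'] at hij

theorem QOrder.isFuzzyUpperSet_mul_rel (P : QOrder 𝒬 X) (p : Q) (a : X) :
    IsFuzzyUpperSet P fun x => 𝒬.mul p (P.rel a x) := by
  intro x y
  change 𝒬.mul (P.rel x y) (𝒬.mul p (P.rel a x)) ≤ 𝒬.mul p (P.rel a y)
  rw [← 𝒬.mul_assoc, 𝒬.mul_comm (P.rel x y) p, 𝒬.mul_assoc]
  exact 𝒬.mul_le_mul_left p (P.rel_trans a x y)

theorem mul_le_tensor_mul_rel (P : QOrder 𝒬 X) (φ : X → Q) (p : Q) (a : X) :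
    𝒬.mul p (φ a) ≤ tensor 𝒬 φ fun x => 𝒬.mul p (P.rel a x) := by
  refine le_iSup_of_le (f := fun x => 𝒬.mul (φ x) (𝒬.mul p (P.rel a x))) a ?_
  rw [𝒬.mul_comm p]
  refine 𝒬.mul_le_mul_left _ ?_
  calc p = 𝒬.mul p 𝒬.unit := (𝒬.mul_unit p).symm
    _ ≤ _ := 𝒬.mul_le_mul_left p (P.unit_le_rel a)

theorem IsFlatIdeal.mul_inf_mul_le {P : QOrder 𝒬 X} {φ : X → Q} (h : IsFlatIdeal P φ)
    (p q : Q) (a b : X) :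
    𝒬.mul p (φ a) ⊓ 𝒬.mul q (φ b) ≤
      ⨆ x, 𝒬.mul (φ x) (𝒬.mul p (P.rel a x) ⊓ 𝒬.mul q (P.rel b x)) :=
  (inf_le_inf (mul_le_tensor_mul_rel P φ p a) (mul_le_tensor_mul_rel P φ q b)).trans
    (h.flat _ _ (P.isFuzzyUpperSet_mul_rel p a) (P.isFuzzyUpperSet_mul_rel q b)).ge

/-- Over a chain, flatness can be tested on the generating fuzzy upper sets `p & P(a, -)`. -/
theorem isFlatIdeal_of_mul_inf_mul_le (hQ : ∀ a b : Q, a ≤ b ∨ b ≤ a) {P : QOrder 𝒬 X}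
    {φ : X → Q} (hφ : IsFuzzyLowerSet P φ) (hi : 𝒬.unit ≤ ⨆ x, φ x)
    (h : ∀ (p q : Q) (a b : X), 𝒬.mul p (φ a) ⊓ 𝒬.mul q (φ b) ≤
      ⨆ x, 𝒬.mul (φ x) (𝒬.mul p (P.rel a x) ⊓ 𝒬.mul q (P.rel b x))) :
    IsFlatIdeal P φ where
  isFuzzyLowerSet := hφ
  inhabited := hi
  flat ψ₁ ψ₂ h₁ h₂ := by
    refine le_antisymm (le_inf (iSup_mono fun x => 𝒬.mul_le_mul_left _ inf_le_left)
      (iSup_mono fun x => 𝒬.mul_le_mul_left _ inf_le_right))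
      (iSup_inf_iSup_le_of_total hQ _ _ fun a b => ?_)
    rw [𝒬.mul_comm (φ a), 𝒬.mul_comm (φ b)]
    -- The weights are p = ψ₁(a) and q = ψ₂(b); upper sets satisfy ψ₁(a) & P(a, x) ≤ ψ₁(x).
    refine (h _ _ a b).trans (iSup_mono fun x => 𝒬.mul_le_mul_left _ (inf_le_inf ?_ ?_))
    · rw [𝒬.mul_comm]
      exact h₁ a x
    · rw [𝒬.mul_comm]
      exact h₂ b x

end FlatIdeal

/-! ### Arithmetic around idempotents. -/

namespace ContinuousTNorm

variable (T : ContinuousTNorm)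

theorem mul_eq_inf {e : unitInterval} (he : T.IsIdem e) (x : unitInterval) :
    T.mul x e = x ⊓ e := by
  refine le_antisymm (le_inf (T.mul_le_left x e) (T.mul_le_right x e)) ?_
  rw [← T.mul_idem_of_le he (inf_le_right : x ⊓ e ≤ e)]
  exact T.mul_le_mul inf_le_left le_rfl

theorem mul_eq_left {e x y : unitInterval} (he : T.IsIdem e) (hx : x ≤ e) (hy : e ≤ y) :
    T.mul x y = x :=
  le_antisymm (T.mul_le_left x y) <|
    (T.mul_idem_of_le he hx).symm.le.trans (T.mul_le_mul_left x hy)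

/-- Otherwise `e` lies below a → x, and a ∧ e = a & e ≤ x. -/
theorem imp_le_of_lt_inf {e a x : unitInterval} (he : T.IsIdem e) (hx : x < a ⊓ e) :
    T.imp a x ≤ e := by
  by_contra h
  have h1 := (T.mul_le_iff a e x).mpr (not_le.mp h).le
  rw [T.mul_eq_inf he] at h1
  exact absurd h1 hx.not_ge

theorem le_imp (a x : unitInterval) : x ≤ T.imp a x :=
  (T.mul_le_iff _ _ _).mp (T.mul_le_right a x)

theorem imp_eq_one {a x : unitInterval} (h : a ≤ x) : T.imp a x = 1 :=
  le_antisymm (unitInterval.le_one _) ((T.mul_le_iff _ _ _).mp ((T.mul_one' a).le.trans h))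

theorem imp_anti {a b : unitInterval} (h : a ≤ b) (x : unitInterval) : T.imp b x ≤ T.imp a x := by
  rw [← T.mul_le_iff]
  exact (T.mul_le_mul h le_rfl).trans ((T.mul_le_iff _ _ _).mpr le_rfl)

theorem le_down_of_isIdem {x c : unitInterval} (h : T.IsIdem x) (hx : x ≤ c) :
    x ≤ T.down c := le_sSup ⟨hx, h⟩

theorem up_le_of_isIdem {x c : unitInterval} (h : T.IsIdem x) (hx : c ≤ x) :
    T.up c ≤ x := sInf_le ⟨hx, h⟩

/-- Undoes the clamping of `b` at `e`: when e ≤ b, e ∧ (e → x) = e & (e → x) ≤ x ≤ b → x. -/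
theorem inf_imp_le_imp {e x : unitInterval} (he : T.IsIdem e) (b : unitInterval) :
    e ⊓ T.imp (b ⊓ e) x ≤ T.imp b x := by
  rcases le_total b e with h | h
  · rw [inf_eq_left.mpr h]
    exact inf_le_right
  · rw [inf_eq_right.mpr h, inf_comm, ← T.mul_eq_inf he, T.mul_comm]
    exact ((T.mul_le_iff _ _ _).mpr le_rfl).trans (T.le_imp b x)

end ContinuousTNorm

/-! ### Necessity, then sufficiency, of the three conditions. -/

section UnitInterval

variable {T : ContinuousTNorm} {φ : unitInterval → unitInterval}

theorem IsFuzzyLowerSet.antitone (hφ : IsFuzzyLowerSet T.dL φ) : Antitone φ := by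
  intro x y h
  have h1 : T.mul (φ y) (T.imp x y) ≤ φ x := hφ y x
  rwa [T.imp_eq_one h, T.mul_one'] at h1

theorem IsFuzzyLowerSet.mul_le (hφ : IsFuzzyLowerSet T.dL φ) (x y : unitInterval) :
    T.mul (φ x) x ≤ φ y :=
  (T.mul_le_mul_left _ (T.le_imp y x)).trans (hφ x y)

theorem IsFlatIdeal.apply_zero (h : IsFlatIdeal T.dL φ) : φ 0 = 1 := by
  refine le_antisymm (unitInterval.le_one _) ?_
  rw [← T.unit_eq_one]
  exact h.inhabited.trans (iSup_le fun x => h.isFuzzyLowerSet.antitone (unitInterval.nonneg x))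

/-- Test flatness with weights φ(c) at 0 and 1 at c: points x ≥ c contribute at most φ(c) & φ(c),
and points x < c at most c → x ≤ c⁺, which lies below the idempotent φ(c)⁻. -/
theorem IsFlatIdeal.isIdem_apply (h : IsFlatIdeal T.dL φ) {c : unitInterval}
    (hc : T.up c ≤ φ c) : T.IsIdem (φ c) := by
  have h1 : T.mul (φ c) (φ 0) ⊓ T.mul 1 (φ c) ≤ ⨆ x, T.mul (φ x)
      (T.mul (φ c) (T.imp 0 x) ⊓ T.mul 1 (T.imp c x)) := h.mul_inf_mul_le (φ c) 1 0 c
  rw [h.apply_zero, T.mul_comm 1, T.mul_one', inf_idem] at h1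
  have h2 : φ c ≤ T.mul (φ c) (φ c) ⊔ T.down (φ c) := by
    refine h1.trans (iSup_le fun x => ?_)
    rcases le_or_gt c x with hx | hx
    · exact le_sup_of_le_left (T.mul_le_mul (h.isFuzzyLowerSet.antitone hx)
        (inf_le_left.trans (T.mul_le_left _ _)))
    · refine le_sup_of_le_right ?_
      refine (T.mul_le_right _ _).trans (inf_le_right.trans ((T.mul_le_right _ _).trans ?_))
      exact (T.imp_le_of_lt_inf (T.up_isIdem c) (lt_inf_iff.mpr ⟨hx, hx.trans_le (T.le_up c)⟩)).trans
        (T.le_down_of_isIdem (T.up_isIdem c) hc)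
  rcases le_sup_iff.mp h2 with h3 | h3
  · exact le_antisymm (T.mul_le_left _ _) h3
  · rw [le_antisymm h3 (T.down_le _)]
    exact T.down_isIdem _

theorem IsFlatIdeal.up_le_apply_down (h : IsFlatIdeal T.dL φ) {c : unitInterval}
    (hc : T.down c < φ (T.down c)) : T.up c ≤ φ (T.down c) := by
  have h1 : T.IsIdem (φ (T.down c)) := h.isIdem_apply
    ((T.up_le_of_isIdem (T.down_isIdem c) le_rfl).trans hc.le)
  refine T.up_le_of_isIdem h1 (le_of_not_ge fun h2 => ?_)
  exact hc.not_ge (T.le_down_of_isIdem h1 h2)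

theorem IsFlatIdeal.restrict (h : IsFlatIdeal T.dL φ) {c : unitInterval}
    (hc : T.down c < φ (T.down c)) {σ : Icc (T.down c) (T.up c) → Icc (T.down c) (T.up c)}
    (hσ : ∀ x, (σ x : unitInterval) = T.up c ⊓ φ x) :
    IsFlatIdeal (T.localQuantale c).dL σ := by
  have hup := T.up_isIdem c
  have hd : T.down c ≤ T.up c := (T.down_le c).trans (T.le_up c)
  have : Nonempty (Icc (T.down c) (T.up c)) := ⟨⟨_, le_rfl, hd⟩⟩
  refine isFlatIdeal_of_mul_inf_mul_le le_total ?_ ?_ ?_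
  · intro x y
    refine Subtype.coe_le_coe.mp ?_
    change T.mul (σ x) ((T.localQuantale c).dL.rel y x : unitInterval) ≤ σ y
    rw [T.coe_localQuantale_dL, hσ, hσ]
    exact le_inf ((T.mul_le_left _ _).trans inf_le_left)
      ((T.mul_le_mul inf_le_right inf_le_right).trans (h.isFuzzyLowerSet _ _))
  · refine le_iSup_of_le ⟨_, le_rfl, hd⟩ (Subtype.coe_le_coe.mp ?_)
    rw [hσ]
    exact le_inf le_rfl (h.up_le_apply_down hc)
  · intro p q a b
    refine Subtype.coe_le_coe.mp ?_
    have key : T.mul p (φ a) ⊓ T.mul q (φ b) ≤ ⨆ x, T.mul (φ x)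
      (T.mul p (T.imp a x) ⊓ T.mul q (T.imp b x)) := h.mul_inf_mul_le (p : unitInterval) q a b
    have hL : ((T.localQuantale c).mul p (σ a) ⊓ (T.localQuantale c).mul q (σ b) :
        Icc (T.down c) (T.up c)).1 ≤ T.mul p (φ a) ⊓ T.mul q (φ b) := by
      change T.mul p (σ a) ⊓ T.mul q (σ b) ≤ _
      rw [hσ, hσ]
      exact inf_le_inf (T.mul_le_mul_left _ inf_le_right) (T.mul_le_mul_left _ inf_le_right)
    refine hL.trans (key.trans (iSup_le fun x => ?_))
    rcases lt_or_ge x (T.down c) with hx | hx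
    -- A point below c⁻ contributes at most a → x ≤ c⁻, the bottom of the local quantale.
    · refine le_trans ?_ (⨆ x, _ : Icc (T.down c) (T.up c)).2.1
      refine (T.mul_le_right _ _).trans (inf_le_left.trans ((T.mul_le_right _ _).trans ?_))
      exact T.imp_le_of_lt_inf (T.down_isIdem c) (lt_inf_iff.mpr ⟨hx.trans_le a.2.1, hx⟩)
    · have hx' : T.down c ≤ x ⊓ T.up c := le_inf hx hd
      refine le_trans ?_ (Subtype.coe_le_coe.mpr (le_iSup _ ⟨x ⊓ T.up c, hx', inf_le_right⟩))
      -- Truncating at c⁺ costs nothing, because p = p & c⁺ and a ≤ c⁺.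
      have himp (p a : Icc (T.down c) (T.up c)) : T.mul p (T.imp a x) ≤
          T.mul p (T.up c ⊓ T.imp a (x ⊓ T.up c)) := by
        conv_lhs => rw [← T.mul_idem_of_le hup p.2.2, T.mul_assoc, T.mul_comm (T.up c),
          T.mul_eq_inf hup, inf_comm]
        refine T.mul_le_mul_left _ (inf_le_inf_left _ ?_)
        rw [← T.mul_le_iff]
        exact le_inf ((T.mul_le_iff _ _ _).mpr le_rfl) ((T.mul_le_left _ _).trans a.2.2)
      change _ ≤ T.mul (σ _) (T.mul p ((T.localQuantale c).dL.rel a _ : unitInterval) ⊓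
        T.mul q ((T.localQuantale c).dL.rel b _ : unitInterval))
      rw [T.coe_localQuantale_dL, T.coe_localQuantale_dL, hσ]
      have hle : T.mul p (T.imp a x) ⊓ T.mul q (T.imp b x) ≤ T.up c :=
        inf_le_left.trans ((T.mul_le_left _ _).trans p.2.2)
      calc T.mul (φ x) (T.mul p (T.imp a x) ⊓ T.mul q (T.imp b x))
          = T.mul (T.up c ⊓ φ x) (T.mul p (T.imp a x) ⊓ T.mul q (T.imp b x)) := by
            rw [inf_comm (T.up c), ← T.mul_eq_inf hup, T.mul_assoc, T.mul_comm (T.up c),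
              T.mul_idem_of_le hup hle]
        _ ≤ _ := T.mul_le_mul
            (inf_le_inf_left _ (h.isFuzzyLowerSet.antitone inf_le_left))
            (inf_le_inf (himp p a) (himp q b))

theorem mul_inf_mul_le_of_le (hφ : IsFuzzyLowerSet T.dL φ)
    (h₂ : ∀ c, T.up c ≤ φ c → T.IsIdem (φ c))
    (h₃ : ∀ c, ¬ T.IsIdem c → T.down c < φ (T.down c) →
      ∃ σ : Icc (T.down c) (T.up c) → Icc (T.down c) (T.up c),
        (∀ x, (σ x : unitInterval) = T.up c ⊓ φ x) ∧ IsFlatIdeal (T.localQuantale c).dL σ)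
    (p q : unitInterval) {a b : unitInterval} (hab : a ≤ b) :
    T.mul p (φ a) ⊓ T.mul q (φ b) ≤
      ⨆ x, T.mul (φ x) (T.mul p (T.imp a x) ⊓ T.mul q (T.imp b x)) := by
  have hb : T.mul (φ b) (p ⊓ q) ≤
      ⨆ x, T.mul (φ x) (T.mul p (T.imp a x) ⊓ T.mul q (T.imp b x)) := by
    refine le_iSup_of_le b ?_
    rw [T.imp_eq_one hab, T.imp_eq_one le_rfl, T.mul_one', T.mul_one']
  rcases le_total q p with hqp | hpq
  · refine le_trans ?_ hb
    rw [inf_eq_right.mpr hqp, T.mul_comm (φ b)]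
    exact inf_le_right
  rw [inf_eq_left.mpr hpq] at hb
  have hup := T.up_isIdem p
  have hdn := T.down_isIdem p
  rcases le_or_gt (T.up p) (φ b) with hM | hM
  · refine le_trans ?_ hb
    rw [T.mul_comm (φ b), T.mul_eq_left hup (T.le_up p) hM]
    exact inf_le_left.trans (T.mul_le_left _ _)
  rcases le_or_gt (φ b) (T.down p) with hm | hm
  · refine le_trans ?_ hb
    rw [T.mul_eq_left hdn hm (T.down_le p)]
    exact inf_le_right.trans (T.mul_le_right _ _)
  have hp : ¬ T.IsIdem p := fun hp =>
    (hm.trans_le' (T.le_down_of_isIdem hp le_rfl)).not_ge (hM.le.trans (T.up_le_of_isIdem hp le_rfl))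
  -- Otherwise b⁺ ≤ p⁻ < φ(b), and (F2) gives an idempotent strictly between p⁻ and p⁺.
  have hmb : T.down p ≤ b := by
    by_contra hlt
    have h4 : T.up b ≤ T.down p := T.up_le_of_isIdem hdn (not_le.mp hlt).le
    have h5 := h₂ b (h4.trans hm.le)
    rcases le_total p (φ b) with h | h
    · exact hM.not_ge (T.up_le_of_isIdem h5 h)
    · exact hm.not_ge (T.le_down_of_isIdem h5 h)
  obtain ⟨σ, hσ, hflat⟩ := h₃ p hp (hm.trans_le (hφ.antitone hmb))
  have hd : T.down p ≤ T.up p := (T.down_le p).trans (T.le_up p)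
  have : Nonempty (Icc (T.down p) (T.up p)) := ⟨⟨_, le_rfl, hd⟩⟩
  have hσanti (x : Icc (T.down p) (T.up p)) : (σ x : unitInterval) ≤ T.up p ⊓ φ (T.down p) := by
    rw [hσ]
    exact inf_le_inf_left _ (hφ.antitone x.2.1)
  -- `φ` is antitone, so inhabitedness of `σ` is decided at p⁻.
  have hone : T.up p ≤ φ (T.down p) := by
    have h6 := Subtype.coe_le_coe.mpr hflat.inhabited
    rw [Icc.coe_iSup hd] at h6
    exact h6.trans ((iSup_le hσanti).trans inf_le_right)
  have hclamp (x : unitInterval) :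
      ∃ y : Icc (T.down p) (T.up p), (y : unitInterval) = (x ⊔ T.down p) ⊓ T.up p :=
    ⟨⟨_, le_inf le_sup_right hd, inf_le_right⟩, rfl⟩
  obtain ⟨a', ha'⟩ := hclamp a
  obtain ⟨b', hb'⟩ := hclamp b
  obtain ⟨q', hq'⟩ := hclamp q
  rw [sup_eq_left.mpr hmb] at hb'
  rw [sup_eq_left.mpr ((T.down_le p).trans hpq)] at hq'
  have key := Subtype.coe_le_coe.mpr
    (hflat.mul_inf_mul_le ⟨p, T.down_le p, T.le_up p⟩ q' a' b')
  rw [Icc.coe_iSup hd] at key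
  -- Clamping does not lower the left side: p = p & p⁺ caps φ(a) at p⁺, and φ(b) < p⁺ likewise caps
  -- q.
  have hL : T.mul p (φ a) ⊓ T.mul q (φ b) ≤ T.mul p (σ a') ⊓ T.mul q' (σ b') := by
    refine inf_le_inf ?_ ?_
    · have h7 : φ a ⊓ T.up p ≤ σ a' := by
        rw [hσ, ha', inf_comm]
        refine le_inf inf_le_left ?_
        rcases le_total a (T.down p) with h | h
        · rw [sup_eq_right.mpr h, inf_eq_left.mpr hd]
          exact inf_le_left.trans hone
        · rw [sup_eq_left.mpr h]
          exact inf_le_right.trans (hφ.antitone inf_le_left)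
      refine le_trans ?_ (T.mul_le_mul_left p h7)
      rw [← T.mul_eq_inf hup, ← T.mul_assoc]
      exact (T.mul_idem_of_le hup ((T.mul_le_left _ _).trans (T.le_up p))).ge
    · have h8 : φ b ≤ σ b' := by
        rw [hσ, hb']
        exact le_inf hM.le (hφ.antitone inf_le_left)
      refine le_trans ?_ (T.mul_le_mul_left _ h8)
      rw [hq', ← T.mul_eq_inf hup, T.mul_assoc, T.mul_comm (T.up p), T.mul_idem_of_le hup hM.le]
  refine hL.trans (key.trans (iSup_le fun x => le_iSup_of_le (x : unitInterval) ?_))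
  change T.mul (σ x) (T.mul p ((T.localQuantale p).dL.rel a' x : unitInterval) ⊓
    T.mul q' ((T.localQuantale p).dL.rel b' x : unitInterval)) ≤ _
  rw [T.coe_localQuantale_dL, T.coe_localQuantale_dL, hσ]
  refine T.mul_le_mul inf_le_right (inf_le_inf (T.mul_le_mul_left _ ?_) (T.mul_le_mul ?_ ?_))
  · refine le_trans (inf_le_inf_left _ ?_) (T.inf_imp_le_imp hup a)
    rw [ha']
    exact T.imp_anti (inf_le_inf_right _ le_sup_left) x
  · rw [hq']
    exact inf_le_left
  · rw [hb']
    exact T.inf_imp_le_imp hup b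

end UnitInterval

end FuzzyOrder

end

theorem theorem3p3 (T : FuzzyOrder.ContinuousTNorm) (φ : unitInterval → unitInterval)
    (hφ : FuzzyOrder.IsFuzzyLowerSet T.dL φ) :
    FuzzyOrder.IsFlatIdeal T.dL φ ↔
      φ 0 = 1 ∧
      (∀ c : unitInterval, T.up c ≤ φ c → T.IsIdem (φ c)) ∧
      (∀ c : unitInterval, ¬ T.IsIdem c → T.down c < φ (T.down c) →
        ∃ σ : Set.Icc (T.down c) (T.up c) → Set.Icc (T.down c) (T.up c),
          (∀ x, (σ x : unitInterval) = T.up c ⊓ φ x) ∧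
          FuzzyOrder.IsFlatIdeal (T.localQuantale c).dL σ) := by
  constructor
  · intro h
    refine ⟨h.apply_zero, fun c => h.isIdem_apply, fun c _ hc => ?_⟩
    -- φ(c⁻) & c⁻ = c⁻ is a lower bound for all values of `φ`.
    have hle (x : Set.Icc (T.down c) (T.up c)) : T.down c ≤ φ x := by
      have h1 := hφ.mul_le (T.down c) x
      rwa [T.mul_eq_inf (T.down_isIdem c), inf_eq_right.mpr hc.le] at h1
    exact ⟨fun x => ⟨T.up c ⊓ φ x, le_inf ((T.down_le c).trans (T.le_up c)) (hle x), inf_le_left⟩,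
      fun _ => rfl, h.restrict hc fun _ => rfl⟩
  · rintro ⟨h₁, h₂, h₃⟩
    refine FuzzyOrder.isFlatIdeal_of_mul_inf_mul_le le_total hφ ?_ fun p q a b => ?_
    · rw [T.unit_eq_one, ← h₁]
      exact le_iSup φ 0
    · rcases le_total a b with hab | hab
      · exact FuzzyOrder.mul_inf_mul_le_of_le hφ h₂ h₃ p q hab
      · rw [inf_comm]
        simp only [inf_comm (T.mul p _)]
        exact FuzzyOrder.mul_inf_mul_le_of_le hφ h₂ h₃ q p hab
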